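/- For $\tau\in\mathbb C$ with $\operatorname{Im}\tau>0$ let $L_\tau=\mathbb Z+\mathbb Z\tau$, $$g_2(\tau)=60\sum_{0\ne\omega\in L_\tau}\omega^{-4},\qquad g_3(\tau)=140\sum_{0\neq\omega\in L_\tau}\omega^{-6},\qquad \Delta(\tau)=g_2(\tau)^3-27g_3(\tau)^2,\qquad J(\tau)=\frac{g_2(\tau)^3}{\Delta(\tau)},$$ and let ${}_2F_1(a,b;c;z)=\sum_{n\ge 0}\frac{(a)_n(b)_n}{(c)_n}\frac{z^n}{n!}$. **Theorem (Kummer's solution).** For all $\tau$ with $\operatorname{Im}(\tau)>1.25$ one has $\Delta(\tau)\neq 0$ and $|J(\tau)|>1$ (so that the series below converges absolutely), and $$\Delta(\tau)^{1/12}=\frac{2\pi}{\sqrt[4]{12}}\cdot J(\tau)^{-1/12}\cdot{}_2F_1\!\left(\tfrac1{12},\tfrac5{12};1;\tfrac1{J(\tau)}\right).$$ Here $\sqrt[4]{12}>0$, and the twelfth roots are understood as follows. There are continuous branches of $\Delta^{1/12}$ and of $J^{1/12}$ on the half-plane $\operatorname{Im}(\tau)>1.25$ that take positive real values for $\operatorname{Re}(\tau)=0$,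 and for these branches (with $J^{-1/12}=1/J^{1/12}$) the formula holds exactly on the whole half-plane. For any other continuous branches of $\Delta^{1/12}$ and $J^{1/12}$ on this half-plane the formula holds up to a constant factor $\zeta$ with $\zeta^{12}=1$. -/

import Mathlib

open UpperHalfPlane Complex

namespace KummerSolution

/-- The pair of basic periods `(1, τ)`, for `τ` in the upper half-plane.
Its lattice is `L_τ = ℤ + ℤ τ`. -/
def periodPair (τ : ℍ) : PeriodPair where
  ω₁ := 1
  ω₂ := τ
  indep := by
    rw [LinearIndependent.pair_iff]
    intro s t h
    have him : t * τ.im = 0 := by simpa using congrArg Complex.im h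
    have ht : t = 0 := (mul_eq_zero.mp him).resolve_right τ.im_pos.ne'
    subst ht
    have hre : s = 0 := by simpa using congrArg Complex.re h
    exact ⟨hre, rfl⟩

/-- The discriminant `Δ(L) = g₂(L)³ - 27 g₃(L)²` of the period lattice,
where `g₂(L) = 60 ∑ ω⁻⁴` and `g₃(L) = 140 ∑ ω⁻⁶`, summed over the nonzero `ω ∈ L`. -/
noncomputable def latticeDisc (L : PeriodPair) : ℂ := L.g₂ ^ 3 - 27 * L.g₃ ^ 2

/-- Klein's absolute invariant `J(L) = g₂(L)³ / (g₂(L)³ - 27 g₃(L)²)` of the period lattice. -/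
noncomputable def latticeJ (L : PeriodPair) : ℂ := L.g₂ ^ 3 / (L.g₂ ^ 3 - 27 * L.g₃ ^ 2)

/-- `Δ(τ) = Δ(L_τ)`. -/
noncomputable def Delta (τ : ℍ) : ℂ := latticeDisc (periodPair τ)

/-- `J(τ) = J(L_τ)`. -/
noncomputable def J (τ : ℍ) : ℂ := latticeJ (periodPair τ)

/-- The half-plane `Im τ > 1.25`. -/
def region : Set ℍ := {τ | 1.25 < τ.im}

/-- `r` is a continuous branch of the twelfth root `f ^ (1/12)` on the half-plane `region`. -/
def IsTwelfthRootBranch (f r : ℍ → ℂ) : Prop :=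
  ContinuousOn r region ∧ ∀ τ ∈ region, r τ ^ 12 = f τ

/-- The constant `2π / 12^(1/4)` with the positive real fourth root. -/
noncomputable def kummerConst : ℝ := 2 * Real.pi / (12 : ℝ) ^ (1 / 4 : ℝ)

/-- The series `₂F₁(1/12, 5/12; 1; 1/J(τ))`. -/
noncomputable def F (τ : ℍ) : ℂ :=
  ordinaryHypergeometric (1 / 12 : ℂ) (5 / 12 : ℂ) (1 : ℂ) (1 / J τ)

end KummerSolution

namespace KummerSolution

open Filter Topology ModularForm EisensteinSeries MatrixGroups Manifold Function Derivative

/-! ### Holomorphic functions at the cusp -/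

/-! Everything reduces to the identity F^4 = E₄, where F = ₂F₁(1/12, 5/12; 1; 1/J). Since g₂ =
(4π⁴/3) E₄ and Δ = (2π)^12 η^24, the function 2πη² is a branch of Δ^(1/12). Given F^4 = E₄, the
quotient c·F/(2πη²) with c = 2π/12^(1/4) has twelfth power J, so it is a branch of J^(1/12), and the
formula is its definition rearranged. Other branches differ from these by twelfth roots of unity,
which are constant on a connected set.

The identity is proved by differential equations. Put D = (2πi)⁻¹ d/dτ, t = 1/J and θ = z d/dz.
Ramanujan's equations for E₂, E₄, E₆ follow from the absence of level-one cusp forms of weight below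
12; they give D t = t E₆/E₄ and D E₄ = (E₂E₄ - E₆)/3. Hence F and E₄^(1/4) have equal logarithmic
derivatives exactly when `wronskian` vanishes. By the hypergeometric equation the wronskian W
satisfies a first-order linear equation which makes W^4/E₄^5 constant; this quotient tends to 0 at
i∞, so W = 0. Then F^4/E₄ is constant with limit 1.

Convergence needs |1/J| < 1, which follows from explicit bounds for |q| ≤ 1/2500. -/

/-- A function on the upper half-plane with a holomorphic `q`-expansion. -/
structure HasHolomorphicQExpansion (f : ℍ → ℂ) : Prop where
  periodic : Periodic (f ∘ ofComplex) ((1 : ℝ) : ℂ)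
  mdiff : MDiff f
  bounded : IsBoundedAtImInfty f

lemma HasHolomorphicQExpansion.normalizedDeriv_eq {f : ℍ → ℂ} (hf : HasHolomorphicQExpansion f)
    (τ : ℍ) : D f τ = Periodic.qParam 1 τ * deriv (cuspFunction 1 f) (Periodic.qParam 1 τ) := by
  have hq : HasDerivAt (Periodic.qParam 1)
      (2 * Real.pi * Complex.I * Periodic.qParam 1 τ) (τ : ℂ) := by
    have h : HasDerivAt (fun z : ℂ ↦ 2 * Real.pi * Complex.I * z / ((1 : ℝ) : ℂ))
        (2 * Real.pi * Complex.I) (τ : ℂ) := by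
      simpa using (hasDerivAt_id (τ : ℂ)).const_mul (2 * Real.pi * Complex.I)
    have h' := h.cexp
    rw [mul_comm (cexp _)] at h'
    exact h'
  have hc : HasDerivAt (cuspFunction 1 f) (deriv (cuspFunction 1 f) (Periodic.qParam 1 τ))
      (Periodic.qParam 1 τ) :=
    (differentiableAt_cuspFunction one_pos hf.periodic hf.mdiff hf.bounded
      (Periodic.norm_qParam_lt_one one_pos τ.im_pos)).hasDerivAt
  have h := hc.comp (τ : ℂ) hq
  have he : f ∘ ofComplex =ᶠ[𝓝 (τ : ℂ)] cuspFunction 1 f ∘ Periodic.qParam 1 := by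
    filter_upwards [isOpen_upperHalfPlaneSet.mem_nhds τ.im_pos] with z hz
    simpa [ofComplex_apply_of_im_pos hz] using
      (eq_cuspFunction (⟨z, hz⟩ : ℍ) one_ne_zero hf.periodic).symm
  rw [normalizedDerivOfComplex, (h.congr_of_eventuallyEq he).deriv]
  field_simp

/-- D acts as q d/dq, and the factor q tends to 0 at the cusp. -/
lemma HasHolomorphicQExpansion.tendsto_normalizedDeriv {f : ℍ → ℂ}
    (hf : HasHolomorphicQExpansion f) : Tendsto (D f) atImInfty (𝓝 0) := by
  have hc : ContinuousAt (deriv (cuspFunction 1 f)) 0 :=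
    (analyticAt_cuspFunction_zero one_pos hf.periodic hf.mdiff hf.bounded).deriv.continuousAt
  have hq := qParam_tendsto_atImInfty one_pos
  have := hq.mul (hc.tendsto.comp hq)
  rw [zero_mul] at this
  exact this.congr fun τ ↦ (hf.normalizedDeriv_eq τ).symm

lemma HasHolomorphicQExpansion.tendsto {f : ℍ → ℂ} (hf : HasHolomorphicQExpansion f) :
    Tendsto f atImInfty (𝓝 (cuspFunction 1 f 0)) := by
  have hc : ContinuousAt (cuspFunction 1 f) 0 :=
    (analyticAt_cuspFunction_zero one_pos hf.periodic hf.mdiff hf.bounded).continuousAt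
  exact (hc.tendsto.comp (qParam_tendsto_atImInfty one_pos)).congr
    fun τ ↦ eq_cuspFunction τ one_ne_zero hf.periodic

lemma hasHolomorphicQExpansion_modularForm {k : ℤ} (f : ModularForm 𝒮ℒ k) :
    HasHolomorphicQExpansion f :=
  have : Fact (IsCusp OnePoint.infty 𝒮ℒ) :=
    ⟨Subgroup.isCusp_of_mem_strictPeriods one_pos one_mem_strictPeriods_SL⟩
  ⟨SlashInvariantFormClass.periodic_comp_ofComplex f one_mem_strictPeriods_SL,
    ModularFormClass.holo f, ModularFormClass.bdd_at_infty f⟩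

lemma hasHolomorphicQExpansion_of_hasSum {f : ℍ → ℂ} {c : ℕ → ℂ} (hd : MDiff f)
    (hf : ∀ τ : ℍ, HasSum (fun m ↦ c m • Periodic.qParam 1 τ ^ m) (f τ)) :
    HasHolomorphicQExpansion f := by
  refine ⟨fun w ↦ ?_, hd, isBoundedAtImInfty_of_hasSum_qExpansion one_pos hf⟩
  by_cases hw : 0 < w.im
  · have hw' : 0 < (w + ((1 : ℝ) : ℂ)).im := by simpa using hw
    simp only [comp_apply, ofComplex_apply_of_im_pos hw', ofComplex_apply_of_im_pos hw]
    refine (hf _).unique ?_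
    have h := hf ⟨w, hw⟩
    have hp : Periodic.qParam 1 (w + ((1 : ℝ) : ℂ)) = Periodic.qParam 1 w := by
      simp [Periodic.qParam, mul_add, Complex.exp_add]
    simpa only [← hp] using h
  -- Off the half-plane `ofComplex` is constant, so periodicity is automatic.
  · have hw' : (w + ((1 : ℝ) : ℂ)).im ≤ 0 := by simpa using not_lt.mp hw
    simp only [comp_apply, ofComplex_apply_of_im_nonpos hw',
      ofComplex_apply_of_im_nonpos (not_lt.mp hw)]

lemma tendsto_eisensteinSeries_E {k : ℕ} (hk : 3 ≤ k) (hk2 : Even k) :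
    Tendsto (E hk) atImInfty (𝓝 1) := by
  have h := hasHolomorphicQExpansion_modularForm (E hk)
  have h1 := h.tendsto
  have h0 := E_qExpansion_coeff_zero hk hk2
  rw [qExpansion_coeff] at h0
  simp only [Nat.factorial_zero, Nat.cast_one, inv_one, iteratedDeriv_zero, one_mul] at h0
  rwa [h0] at h1

lemma hasHolomorphicQExpansion_E2 : HasHolomorphicQExpansion E2 :=
  hasHolomorphicQExpansion_of_hasSum E2_mdifferentiable fun τ ↦ by
    simpa only [Periodic.qParam, ofReal_one, div_one] using hasSum_qExpansion_E2 (z := τ)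

lemma tendsto_E2 : Tendsto E2 atImInfty (𝓝 1) := by
  have h := hasHolomorphicQExpansion_E2
  have hc := hasFPowerSeriesOnBall_cuspFunction one_pos
    (analyticAt_cuspFunction_zero one_pos h.periodic h.mdiff h.bounded) fun τ ↦ by
      simpa only [Periodic.qParam, ofReal_one, div_one] using hasSum_qExpansion_E2 (z := τ)
  have h0 := hc.coeff_zero 0
  have h1 := h.tendsto
  rw [← h0] at h1
  simpa [FormalMultilinearSeries.ofScalars] using h1

/-! ### Ramanujan's differential equations -/

/-- Invariance carries decay at ∞ to every cusp, so f is a level-one cusp form of weight below 12.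
-/
lemma eq_zero_of_slash_invariant_of_tendsto_zero {k : ℤ} (hk : k < 12) {f : ℍ → ℂ} (hd : MDiff f)
    (hs : ∀ γ : SL(2, ℤ), f ∣[k] γ = f) (h0 : Tendsto f atImInfty (𝓝 0)) : f = 0 := by
  let F : CuspForm 𝒮ℒ k :=
    { toFun := f
      slash_action_eq' := fun A hA ↦ by
        obtain ⟨A, rfl⟩ := hA
        exact hs A
      holo' := hd
      zero_at_cusps' := fun hc ↦ by
        rw [Subgroup.IsArithmetic.isCusp_iff_isCusp_SL2Z] at hc
        rw [OnePoint.isZeroAt_iff_forall_SL2Z hc]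
        intro γ _
        rw [hs]
        exact h0 }
  have hF : F = 0 := rank_zero_iff_forall_zero.mp (CuspForm.rank_eq_zero_of_weight_lt_twelve hk) F
  exact congrArg (fun G : CuspForm 𝒮ℒ k ↦ (G : ℍ → ℂ)) hF

lemma modularForm_slash {k : ℤ} (f : ModularForm 𝒮ℒ k) (γ : SL(2, ℤ)) : ⇑f ∣[k] γ = f :=
  SlashInvariantForm.slash_action_eqn f _ ⟨γ, rfl⟩

/-- The Serre derivative of E₄ is modular of weight 6 with limit -1/3 at the cusp; adding E₆/3
cancels this limit. -/
theorem normalizedDeriv_E4 (τ : ℍ) : D E₄ τ = (E2 τ * E₄ τ - E₆ τ) / 3 := by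
  have hd := ModularFormClass.holo E₄
  have h := eq_zero_of_slash_invariant_of_tendsto_zero (k := 6) (by norm_num)
    (f := serreDerivative (4 : ℤ) E₄ + (1 / 3 : ℂ) • ⇑E₆)
    ((serreDerivative_mdifferentiable _ hd).add ((ModularFormClass.holo E₆).const_smul _))
    (fun γ ↦ by
      rw [SlashAction.add_slash, SL_smul_slash, modularForm_slash]
      congr 1
      exact serreDerivative_slash_invariant (k := 4) hd (modularForm_slash E₄ γ))
    (by
      have h1 := (hasHolomorphicQExpansion_modularForm E₄).tendsto_normalizedDeriv
      have h4 := tendsto_eisensteinSeries_E (k := 4) (by norm_num) ⟨2, rfl⟩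
      have h6 := tendsto_eisensteinSeries_E (k := 6) (by norm_num) ⟨3, rfl⟩
      have := (h1.sub ((tendsto_E2.const_mul ((4 : ℂ) * 12⁻¹)).mul h4)).add
        (h6.const_mul (1 / 3 : ℂ))
      norm_num at this
      refine this.congr fun z ↦ ?_
      simp only [Pi.add_apply, Pi.smul_apply, smul_eq_mul, serreDerivative_apply]
      push_cast
      ring)
  have := congrFun h τ
  simp at this
  linear_combination this

theorem normalizedDeriv_E6 (τ : ℍ) : D E₆ τ = (E2 τ * E₆ τ - E₄ τ ^ 2) / 2 := by
  have hd := ModularFormClass.holo E₆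
  have h := eq_zero_of_slash_invariant_of_tendsto_zero (k := 8) (by norm_num)
    (f := serreDerivative (6 : ℤ) E₆ + (1 / 2 : ℂ) • (⇑E₄ * ⇑E₄))
    ((serreDerivative_mdifferentiable _ hd).add
      (((ModularFormClass.holo E₄).mul (ModularFormClass.holo E₄)).const_smul _))
    (fun γ ↦ by
      rw [SlashAction.add_slash, SL_smul_slash]
      congr 1
      · exact serreDerivative_slash_invariant (k := 6) hd (modularForm_slash E₆ γ)
      · rw [show (8 : ℤ) = 4 + 4 by norm_num, mul_slash_SL2, modularForm_slash])
    (by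
      have h1 := (hasHolomorphicQExpansion_modularForm E₆).tendsto_normalizedDeriv
      have h4 := tendsto_eisensteinSeries_E (k := 4) (by norm_num) ⟨2, rfl⟩
      have h6 := tendsto_eisensteinSeries_E (k := 6) (by norm_num) ⟨3, rfl⟩
      have := (h1.sub ((tendsto_E2.const_mul ((6 : ℂ) * 12⁻¹)).mul h6)).add
        ((h4.mul h4).const_mul (1 / 2 : ℂ))
      norm_num at this
      refine this.congr fun z ↦ ?_
      simp only [Pi.add_apply, Pi.smul_apply, Pi.mul_apply, smul_eq_mul, serreDerivative_apply]
      push_cast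
      ring)
  have := congrFun h τ
  simp at this
  linear_combination this

lemma normalizedDeriv_D2 (γ : SL(2, ℤ)) (τ : ℍ) :
    D (D2 γ) τ = -((γ 1 0 : ℂ) / denom γ τ) ^ 2 := by
  have h := (hasDerivAt_denom_zpow (γ : GL (Fin 2) ℝ) (-1) τ).const_mul
    (2 * Real.pi * Complex.I * γ 1 0)
  have he : D2 γ ∘ ofComplex =ᶠ[𝓝 (τ : ℂ)]
      fun z ↦ 2 * Real.pi * Complex.I * γ 1 0 * denom (γ : GL (Fin 2) ℝ) z ^ (-1 : ℤ) := by
    filter_upwards [isOpen_upperHalfPlaneSet.mem_nhds τ.im_pos] with z hz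
    simp [D2, ofComplex_apply_of_im_pos hz, div_eq_mul_inv]
  rw [normalizedDerivOfComplex, (h.congr_of_eventuallyEq he).deriv]
  have hz := denom_ne_zero (γ : GL (Fin 2) ℝ) τ
  have h2 : (-1 - 1 : ℤ) = -2 := by norm_num
  rw [h2, zpow_neg]
  simp
  field_simp
  rw [Complex.I_sq]
  ring

lemma mdifferentiable_D2 (γ : SL(2, ℤ)) : MDiff (D2 γ) := by
  intro τ
  rw [UpperHalfPlane.mdifferentiableAt_iff]
  have h := (hasDerivAt_denom_zpow (γ : GL (Fin 2) ℝ) (-1) τ).const_mul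
    (2 * Real.pi * Complex.I * γ 1 0)
  have he : D2 γ ∘ ofComplex =ᶠ[𝓝 (τ : ℂ)]
      fun z ↦ 2 * Real.pi * Complex.I * γ 1 0 * denom (γ : GL (Fin 2) ℝ) z ^ (-1 : ℤ) := by
    filter_upwards [isOpen_upperHalfPlaneSet.mem_nhds τ.im_pos] with z hz
    simp [D2, ofComplex_apply_of_im_pos hz, div_eq_mul_inv]
  exact (h.congr_of_eventuallyEq he).differentiableAt

/-- E₂ is only quasimodular. With parameter 1 in place of the weight 2, the terms linear and
quadratic in c/(cτ+d) coming from D E₂ cancel those from E₂²/12. -/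
lemma serreDerivative_E2_slash (γ : SL(2, ℤ)) :
    serreDerivative 1 E2 ∣[(4 : ℤ)] γ = serreDerivative 1 E2 := by
  have h1 := normalizedDerivOfComplex_SL_slash (k := 2) E2_mdifferentiable (γ := γ)
  rw [E2_slash_action, normalizedDerivOfComplex_sub _ _ E2_mdifferentiable
    ((mdifferentiable_D2 γ).const_smul _),
    normalizedDerivOfComplex_smul _ _ (mdifferentiable_D2 γ)] at h1
  have h2 : serreDerivative 1 E2 = D E2 + (-(1 / 12 : ℂ)) • (E2 * E2) := by
    ext z
    simp
    ring
  ext z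
  have h3 := congrFun h1 z
  have h4 : (2 + 2 : ℤ) = 4 := by norm_num
  rw [h2, SlashAction.add_slash, SL_smul_slash]
  have h5 : (E2 * E2) ∣[(4 : ℤ)] γ = (E2 ∣[(2 : ℤ)] γ) * (E2 ∣[(2 : ℤ)] γ) := by
    rw [← h4, mul_slash_SL2]
  rw [h5, E2_slash_action]
  simp only [Pi.sub_apply, Pi.smul_apply, smul_eq_mul, normalizedDeriv_D2, h4, Pi.add_apply,
    Pi.mul_apply, riemannZeta_two, D2] at h3 ⊢
  have hpi : (Real.pi : ℂ) ≠ 0 := by exact_mod_cast Real.pi_ne_zero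
  generalize hx : (γ 1 0 : ℂ) / denom γ z = x at h3
  have hx' : 2 * (Real.pi : ℂ) * Complex.I * (γ 1 0 : ℂ) / denom γ z
      = 2 * Real.pi * Complex.I * x := by rw [← hx]; ring
  rw [hx'] at h3 ⊢
  generalize (D E2 ∣[(4 : ℤ)] γ) z = y at h3 ⊢
  generalize E2 z = e at h3 ⊢
  generalize D E2 z = d at h3 ⊢
  push_cast at h3
  clear hx hx' h1 h2 h5
  field_simp at h3 ⊢
  linear_combination (6 * Complex.I) * h3 + 12 * (Real.pi : ℂ) ^ 2 * (y - d) * Complex.I_sq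

theorem normalizedDeriv_E2 (τ : ℍ) : D E2 τ = (E2 τ ^ 2 - E₄ τ) / 12 := by
  have h := eq_zero_of_slash_invariant_of_tendsto_zero (k := 4) (by norm_num)
    (f := serreDerivative 1 E2 + (1 / 12 : ℂ) • ⇑E₄)
    ((serreDerivative_mdifferentiable _ E2_mdifferentiable).add
      ((ModularFormClass.holo E₄).const_smul _))
    (fun γ ↦ by
      rw [SlashAction.add_slash, SL_smul_slash, modularForm_slash, serreDerivative_E2_slash])
    (by
      have h1 := hasHolomorphicQExpansion_E2.tendsto_normalizedDeriv
      have h4 := tendsto_eisensteinSeries_E (k := 4) (by norm_num) ⟨2, rfl⟩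
      have := (h1.sub ((tendsto_E2.const_mul ((1 : ℂ) * 12⁻¹)).mul tendsto_E2)).add
        (h4.const_mul (1 / 12 : ℂ))
      norm_num at this
      refine this.congr fun z ↦ ?_
      simp only [Pi.add_apply, Pi.smul_apply, smul_eq_mul, serreDerivative_apply]
      push_cast
      ring)
  have := congrFun h τ
  simp at this
  linear_combination this

end KummerSolution

namespace KummerSolution

/-! ### The hypergeometric equation -/

/-- The coefficients of `₂F₁(1/12, 5/12; 1; z)`. -/
noncomputable abbrev hypCoeff (n : ℕ) : ℂ :=
  ordinaryHypergeometricCoefficient (1 / 12 : ℂ) (5 / 12 : ℂ) (1 : ℂ) n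

/-- The function `(z d/dz)^k ₂F₁(1/12, 5/12; 1; z)`, as a power series. -/
noncomputable def hypTheta (k : ℕ) (z : ℂ) : ℂ := ∑' n : ℕ, (n : ℂ) ^ k * hypCoeff n * z ^ n

lemma hypCoeff_zero : hypCoeff 0 = 1 := by
  simp [hypCoeff, ordinaryHypergeometricCoefficient]

lemma hypCoeff_succ (n : ℕ) :
    ((n : ℂ) + 1) ^ 2 * hypCoeff (n + 1) = (n + 1 / 12) * (n + 5 / 12) * hypCoeff n := by
  have h1 : ((n : ℂ) + 1) ≠ 0 := by exact_mod_cast Nat.succ_ne_zero n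
  have h2 : (Nat.factorial n : ℂ) ≠ 0 := by exact_mod_cast Nat.factorial_ne_zero n
  simp only [hypCoeff, ordinaryHypergeometricCoefficient, ascPochhammer_succ_eval,
    ascPochhammer_eval_one, Nat.factorial_succ, Nat.cast_mul, Nat.cast_succ]
  generalize Polynomial.eval (1 / 12) (ascPochhammer ℂ n) = a
  generalize Polynomial.eval (5 / 12) (ascPochhammer ℂ n) = b
  generalize (n : ℂ) = m at h1 ⊢
  have h3 : 1 + m ≠ 0 := by rwa [add_comm]
  field_simp
  ring

/-- Successive ratios (n+1/12)(n+5/12)/(n+1)² lie in [0, 1]. The upper bound gives convergence in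
the unit disc, nonnegativity gives F > 0 on the imaginary axis. -/
lemma exists_nonneg_eq_hypCoeff (n : ℕ) : ∃ x : ℝ, 0 ≤ x ∧ x ≤ 1 ∧ hypCoeff n = x := by
  induction n with
  | zero => exact ⟨1, zero_le_one, le_rfl, by simp [hypCoeff_zero]⟩
  | succ n ih =>
    obtain ⟨x, hx0, hx1, hx⟩ := ih
    have h1 : ((n : ℂ) + 1) ≠ 0 := by exact_mod_cast Nat.succ_ne_zero n
    refine ⟨(n + 1 / 12) * (n + 5 / 12) * x / (n + 1) ^ 2, by positivity, ?_, ?_⟩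
    · rw [div_le_one (by positivity)]
      have hn : (0 : ℝ) ≤ n := n.cast_nonneg
      calc ((n : ℝ) + 1 / 12) * (n + 5 / 12) * x ≤ (n + 1 / 12) * (n + 5 / 12) * 1 := by gcongr
        _ ≤ (n + 1) ^ 2 := by nlinarith
    · have h := hypCoeff_succ n
      rw [hx] at h
      push_cast
      rw [eq_div_iff (pow_ne_zero 2 h1), ← h]
      ring

lemma norm_hypCoeff_le (n : ℕ) : ‖hypCoeff n‖ ≤ 1 := by
  obtain ⟨x, hx0, hx1, hx⟩ := exists_nonneg_eq_hypCoeff n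
  rw [hx, Complex.norm_real, Real.norm_of_nonneg hx0]
  exact hx1

lemma norm_hypTheta_term_le (k n : ℕ) (z : ℂ) :
    ‖(n : ℂ) ^ k * hypCoeff n * z ^ n‖ ≤ (n : ℝ) ^ k * ‖z‖ ^ n := by
  rw [norm_mul, norm_mul, norm_pow, norm_pow, Complex.norm_natCast]
  gcongr
  exact mul_le_of_le_one_right (by positivity) (norm_hypCoeff_le n)

lemma summable_hypTheta (k : ℕ) {z : ℂ} (hz : ‖z‖ < 1) :
    Summable fun n : ℕ ↦ (n : ℂ) ^ k * hypCoeff n * z ^ n :=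
  .of_norm_bounded (summable_pow_mul_geometric_of_norm_lt_one k (by simpa using hz))
    fun n ↦ norm_hypTheta_term_le k n z

lemma hypTheta_zero_eq (z : ℂ) :
    ordinaryHypergeometric (1 / 12 : ℂ) (5 / 12 : ℂ) (1 : ℂ) z = hypTheta 0 z := by
  rw [ordinaryHypergeometric_eq_tsum, hypTheta]
  simp [hypCoeff, ordinaryHypergeometricCoefficient]

/-- Termwise differentiation by locally uniform convergence on a smaller disc. -/
lemma hypTheta_differentiableAt_and (k : ℕ) {z : ℂ} (hz : ‖z‖ < 1) :
    DifferentiableAt ℂ (hypTheta k) z ∧ z * deriv (hypTheta k) z = hypTheta (k + 1) z := by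
  obtain ⟨r, hr, hr1⟩ := exists_between hz
  have hr0 : 0 ≤ r := (norm_nonneg z).trans hr.le
  have hu : Summable fun n : ℕ ↦ (n : ℝ) ^ k * r ^ n :=
    summable_pow_mul_geometric_of_norm_lt_one k (by rwa [Real.norm_of_nonneg hr0])
  have hd (n : ℕ) : DifferentiableOn ℂ (fun w : ℂ ↦ (n : ℂ) ^ k * hypCoeff n * w ^ n)
      (Metric.ball 0 r) := by fun_prop
  have hb (n : ℕ) (w : ℂ) (hw : w ∈ Metric.ball (0 : ℂ) r) :
      ‖(n : ℂ) ^ k * hypCoeff n * w ^ n‖ ≤ (n : ℝ) ^ k * r ^ n := by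
    refine (norm_hypTheta_term_le k n w).trans ?_
    have : ‖w‖ ≤ r := by simpa using (Metric.mem_ball.mp hw).le
    gcongr
  have hzr : z ∈ Metric.ball (0 : ℂ) r := by simpa using hr
  refine ⟨(differentiableOn_tsum_of_summable_norm hu hd Metric.isOpen_ball hb).differentiableAt
    (Metric.isOpen_ball.mem_nhds hzr), ?_⟩
  have h := (hasSum_deriv_of_summable_norm hu hd Metric.isOpen_ball hb hzr).mul_left z
  refine h.tsum_eq.symm.trans (tsum_congr fun n ↦ ?_)
  rw [deriv_const_mul_field, deriv_pow_field]
  cases n with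
  | zero => simp
  | succ n => rw [Nat.add_sub_cancel]; push_cast; ring

lemma hypTheta_hasDerivAt_comp (k : ℕ) {t : ℂ → ℂ} {z s : ℂ} (hz : ‖t z‖ < 1)
    (ht : HasDerivAt t (t z * s) z) :
    HasDerivAt (fun w ↦ hypTheta k (t w)) (hypTheta (k + 1) (t z) * s) z := by
  obtain ⟨h1, h2⟩ := hypTheta_differentiableAt_and k hz
  refine (h1.hasDerivAt.comp z ht).congr_deriv ?_
  rw [← h2]
  ring

theorem hypTheta_equation {z : ℂ} (hz : ‖z‖ < 1) :
    (1 - z) * hypTheta 2 z = z * (1 / 2 * hypTheta 1 z + 5 / 144 * hypTheta 0 z) := by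
  have h0 := (summable_hypTheta 0 hz).hasSum
  have h1 := (summable_hypTheta 1 hz).hasSum
  have h2 := (summable_hypTheta 2 hz).hasSum
  have h3 := (((h1.mul_left (1 / 2)).add (h0.mul_left (5 / 144))).add h2).mul_left z
  -- The factor n² kills the term n = 0, so the index shift loses nothing and the coefficient
  -- recurrence applies.
  have h4 := (hasSum_nat_add_iff' 1).mpr h2
  have h5 := h4.unique (h3.congr_fun fun n ↦ by
    have := hypCoeff_succ n
    push_cast
    rw [this]
    ring)
  simp only [Finset.range_one, Finset.sum_singleton, Nat.cast_zero] at h5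
  simp only [hypTheta]
  linear_combination h5

lemma continuousAt_hypTheta_zero (k : ℕ) : ContinuousAt (hypTheta k) 0 :=
  (hypTheta_differentiableAt_and k (by simp)).1.continuousAt

lemma hypTheta_zero_zero : hypTheta 0 0 = 1 := by
  rw [← hypTheta_zero_eq, ordinaryHypergeometric_zero]

lemma hypTheta_succ_zero (k : ℕ) : hypTheta (k + 1) 0 = 0 := by
  rw [← (hypTheta_differentiableAt_and k (z := 0) (by simp)).2, zero_mul]

lemma exists_pos_eq_hypTheta {x : ℝ} (hx0 : 0 ≤ x) (hx1 : x < 1) :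
    ∃ y : ℝ, 0 < y ∧ hypTheta 0 x = y := by
  choose c hc0 hc1 hc using exists_nonneg_eq_hypCoeff
  have hs : Summable fun n ↦ c n * x ^ n := by
    refine .of_nonneg_of_le (fun n ↦ mul_nonneg (hc0 n) (by positivity)) (fun n ↦ ?_)
      (summable_geometric_of_lt_one hx0 hx1)
    exact mul_le_of_le_one_left (by positivity) (hc1 n)
  refine ⟨∑' n, c n * x ^ n, ?_, ?_⟩
  · refine hs.tsum_pos (fun n ↦ mul_nonneg (hc0 n) (by positivity)) 0 ?_
    have h := hc 0
    rw [hypCoeff_zero] at h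
    have h' : (1 : ℝ) = c 0 := by exact_mod_cast h
    simp [← h']
  · rw [hypTheta, Complex.ofReal_tsum]
    refine tsum_congr fun n ↦ ?_
    rw [hc]
    simp

end KummerSolution

namespace KummerSolution

open ModularForm EisensteinSeries

/-! ### The lattice invariants as Eisenstein series -/

lemma periodPair_G (τ : ℍ) {k : ℕ} (hk : 3 ≤ k) :
    (periodPair τ).G k = 2 * riemannZeta k * E hk τ := by
  have h1 : E hk τ = 1 / 2 * eisensteinSeries (N := 1) 0 k τ := rfl
  have h2 := tsum_eisSummand_eq_riemannZeta_mul_eisensteinSeries hk τ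
  rw [h1]
  have h3 : (periodPair τ).G k = ∑' v : Fin 2 → ℤ, eisSummand k v τ := by
    -- The coordinates are swapped: `eisSummand` puts τ with the first one, `periodPair` with the
    -- second.
    rw [PeriodPair.G, ← (periodPair τ).latticeEquivProd.symm.toEquiv.tsum_eq,
      ← ((finTwoArrowEquiv ℤ).trans (Equiv.prodComm ℤ ℤ)).tsum_eq]
    refine tsum_congr fun v ↦ ?_
    simp only [LinearEquiv.coe_toEquiv, PeriodPair.latticeEquiv_symm_apply, eisSummand]
    simp [periodPair, zpow_neg, add_comm]
  rw [h3, h2]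
  ring

lemma riemannZeta_six : riemannZeta 6 = (Real.pi : ℂ) ^ 6 / 945 := by
  have h := riemannZeta_two_mul_nat (k := 3) (by norm_num)
  have hb : bernoulli 6 = 1 / 42 := by decide +kernel
  norm_num [hb, Nat.factorial] at h
  rw [h]
  ring

lemma periodPair_g₂ (τ : ℍ) : (periodPair τ).g₂ = 4 * (Real.pi : ℂ) ^ 4 / 3 * E₄ τ := by
  have h := periodPair_G τ (k := 4) (by norm_num)
  rw [PeriodPair.g₂, h]
  push_cast
  rw [riemannZeta_four]
  ring

lemma periodPair_g₃ (τ : ℍ) : (periodPair τ).g₃ = 8 * (Real.pi : ℂ) ^ 6 / 27 * E₆ τ := by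
  have h := periodPair_G τ (k := 6) (by norm_num)
  rw [PeriodPair.g₃, h]
  push_cast
  rw [riemannZeta_six]
  ring

theorem Delta_eq (τ : ℍ) : Delta τ = (2 * Real.pi : ℂ) ^ 12 * discriminant τ := by
  rw [Delta, latticeDisc, periodPair_g₂, periodPair_g₃, discriminant_eq_E₄_cube_sub_E₆_sq]
  ring

lemma Delta_ne_zero (τ : ℍ) : Delta τ ≠ 0 := by
  rw [Delta_eq]
  exact mul_ne_zero (pow_ne_zero _ (by simp [Real.pi_ne_zero])) (discriminant_ne_zero τ)

theorem J_eq (τ : ℍ) : J τ = (4 * (Real.pi : ℂ) ^ 4 / 3 * E₄ τ) ^ 3 / Delta τ := by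
  rw [J, latticeJ, ← periodPair_g₂]
  rfl

lemma one_div_J (τ : ℍ) : 1 / J τ = 1728 * discriminant τ / E₄ τ ^ 3 := by
  have hpi : (Real.pi : ℂ) ≠ 0 := by exact_mod_cast Real.pi_ne_zero
  rw [J_eq, Delta_eq, one_div_div]
  by_cases h : E₄ τ = 0
  · simp [h]
  · field_simp
    ring

end KummerSolution

namespace KummerSolution

open ModularForm EisensteinSeries Filter Topology Function

/-! ### Estimates on the half-plane -/

lemma norm_exp_two_pi_I_lt {τ : ℍ} (hτ : τ ∈ region) :
    ‖cexp (2 * Real.pi * Complex.I * τ)‖ ≤ 1 / 2500 := by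
  have h1 : (1.25 : ℝ) < τ.im := hτ
  -- 157/20 = 2 · 3.14 · 1.25. Twentieth powers then turn the bound on exp(157/20) into a rational
  -- comparison.
  have h2 : 157 / 20 ≤ 2 * Real.pi * τ.im := by nlinarith [Real.pi_gt_d2]
  have h3 : (2500 : ℝ) ≤ Real.exp (157 / 20) := by
    have h4 : Real.exp (157 / 20) ^ 20 = Real.exp 1 ^ 157 := by
      rw [← Real.exp_nat_mul, ← Real.exp_nat_mul]
      norm_num
    refine le_of_pow_le_pow_left₀ (n := 20) (by norm_num) (Real.exp_pos _).le ?_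
    rw [h4]
    calc (2500 : ℝ) ^ 20 ≤ 2.718 ^ 157 := by norm_num
      _ ≤ Real.exp 1 ^ 157 := by
        gcongr
        linarith [Real.exp_one_gt_d9]
  rw [Complex.norm_exp, one_div]
  have h5 : (2 * Real.pi * Complex.I * τ : ℂ).re = -(2 * Real.pi * τ.im) := by simp
  rw [h5, Real.exp_neg]
  exact inv_anti₀ (by norm_num) (h3.trans (Real.exp_le_exp.mpr h2))

lemma E4_eq_tsum (τ : ℍ) : E₄ τ = 1 + 240 * ∑' n : ℕ,
    (ArithmeticFunction.sigma 3 (n + 1) : ℂ) * cexp (2 * Real.pi * Complex.I * τ) ^ (n + 1) := by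
  have h := q_expansion_bernoulli (k := 4) (by norm_num) ⟨2, rfl⟩ τ
  have hb : bernoulli 4 = -1 / 30 := by decide +kernel
  have hs := tsum_pnat_eq_tsum_succ (f := fun n : ℕ ↦ (ArithmeticFunction.sigma 3 n : ℂ) *
    cexp (2 * Real.pi * Complex.I * τ) ^ n)
  rw [← hs, h, hb]
  simp only [zpow_natCast]
  norm_num

lemma norm_E4_sub_one_le {τ : ℍ} (hτ : τ ∈ region) : ‖E₄ τ - 1‖ ≤ 240 / 2484 := by
  have hq := norm_exp_two_pi_I_lt hτ
  rw [E4_eq_tsum, add_sub_cancel_left, norm_mul]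
  -- Majorant from σ₃(n+1) ≤ (n+1)^4 ≤ 16^n and |q| ≤ 1/2500.
  have hs : HasSum (fun n : ℕ ↦ (1 / 2500 : ℝ) * (16 / 2500) ^ n) (1 / 2484) := by
    have := (hasSum_geometric_of_lt_one (r := 16 / 2500) (by norm_num) (by norm_num)).mul_left
      (1 / 2500 : ℝ)
    norm_num at this ⊢
    exact this
  have hb := tsum_of_norm_bounded (f := fun n : ℕ ↦ (ArithmeticFunction.sigma 3 (n + 1) : ℂ) *
    cexp (2 * Real.pi * Complex.I * τ) ^ (n + 1)) hs fun n ↦ by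
      rw [norm_mul, norm_pow, Complex.norm_natCast]
      have h1 : (ArithmeticFunction.sigma 3 (n + 1) : ℝ) ≤ 16 ^ n := by
        have h2 : ArithmeticFunction.sigma 3 (n + 1) ≤ (n + 1) ^ 4 :=
          ArithmeticFunction.sigma_le_pow_succ 3 (n + 1)
        have h3 : (n + 1) ^ 4 ≤ (2 ^ n) ^ 4 := Nat.pow_le_pow_left Nat.lt_two_pow_self 4
        have h4 : (2 ^ n) ^ 4 = 16 ^ n := by rw [← pow_mul, mul_comm, pow_mul]; norm_num
        exact_mod_cast h2.trans (h3.trans h4.le)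
      calc (ArithmeticFunction.sigma 3 (n + 1) : ℝ) *
            ‖cexp (2 * Real.pi * Complex.I * τ)‖ ^ (n + 1)
          ≤ 16 ^ n * (1 / 2500) ^ (n + 1) := by gcongr
        _ = 1 / 2500 * (16 / 2500) ^ n := by rw [div_pow, div_pow, one_pow]; ring
  have h240 : ‖(240 : ℂ)‖ = 240 := by norm_num
  rw [h240]
  linarith

lemma norm_E4_ge {τ : ℍ} (hτ : τ ∈ region) : 0.9 ≤ ‖E₄ τ‖ := by
  have h1 := norm_E4_sub_one_le hτ
  have h2 := norm_sub_norm_le (1 : ℂ) (1 - E₄ τ)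
  rw [sub_sub_cancel, norm_one, norm_sub_rev] at h2
  norm_num at h1 ⊢
  linarith

lemma E4_ne_zero {τ : ℍ} (hτ : τ ∈ region) : E₄ τ ≠ 0 := by
  have := norm_E4_ge hτ
  rw [← norm_pos_iff]
  linarith

lemma norm_tprod_one_add_le {ι : Type*} {f : ι → ℂ} (hf : Summable fun i ↦ ‖f i‖) :
    ‖∏' i, (1 + f i)‖ ≤ Real.exp (∑' i, ‖f i‖) := by
  have h := (multipliable_one_add_of_summable hf).hasProd
  refine le_of_tendsto h.norm (Eventually.of_forall fun s ↦ ?_)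
  have h1 : ∏ i ∈ s, ‖1 + f i‖ ≤ ∏ i ∈ s, Real.exp ‖f i‖ := by
    refine Finset.prod_le_prod (fun i _ ↦ norm_nonneg _) fun i _ ↦ ?_
    refine (norm_add_le _ _).trans ?_
    rw [norm_one, add_comm]
    exact Real.add_one_le_exp _
  calc ∏ i ∈ s, ‖1 + f i‖ ≤ ∏ i ∈ s, Real.exp ‖f i‖ := h1
    _ = Real.exp (∑ i ∈ s, ‖f i‖) := (Real.exp_sum _ _).symm
    _ ≤ Real.exp (∑' i, ‖f i‖) :=
      Real.exp_le_exp.mpr (hf.sum_le_tsum s fun i _ ↦ norm_nonneg _)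

lemma norm_discriminant_le {τ : ℍ} (hτ : τ ∈ region) :
    ‖discriminant τ‖ ≤ 1 / 2500 * 1.01 := by
  have hq := norm_exp_two_pi_I_lt hτ
  set q := cexp (2 * Real.pi * Complex.I * τ) with hqdef
  have hs : HasSum (fun n : ℕ ↦ (1 / 2500 : ℝ) ^ (n + 1)) (1 / 2499) := by
    have := (hasSum_geometric_of_lt_one (r := 1 / 2500) (by norm_num) (by norm_num)).mul_left
      (1 / 2500 : ℝ)
    simp only [← pow_succ'] at this
    norm_num at this ⊢
    exact this
  have hle (n : ℕ) : ‖-q ^ (n + 1)‖ ≤ (1 / 2500 : ℝ) ^ (n + 1) := by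
    rw [norm_neg, norm_pow]
    gcongr
  have hsum : Summable fun n : ℕ ↦ ‖-q ^ (n + 1)‖ :=
    .of_nonneg_of_le (fun n ↦ norm_nonneg _) hle hs.summable
  have hP := norm_tprod_one_add_le hsum
  have hP' : ∑' n : ℕ, ‖-q ^ (n + 1)‖ ≤ 1 / 2499 :=
    (hsum.tsum_le_tsum hle hs.summable).trans hs.tsum_eq.le
  -- Uses exp(x) ≤ 1/(1 - x) at x = 24/2499.
  have hexp : Real.exp (1 / 2499) ^ 24 ≤ 1.01 := by
    have h := Real.add_one_le_exp (-(24 / 2499 : ℝ))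
    have h1 : Real.exp (24 / 2499) * Real.exp (-(24 / 2499)) = 1 := by
      rw [← Real.exp_add, add_neg_cancel, Real.exp_zero]
    have h2 : Real.exp (1 / 2499) ^ 24 = Real.exp (24 / 2499) := by
      rw [← Real.exp_nat_mul]
      norm_num
    rw [h2]
    nlinarith [Real.exp_pos (24 / 2499)]
  have hd : discriminant τ = q * (∏' n : ℕ, (1 + -q ^ (n + 1))) ^ 24 := by
    have h1 : Periodic.qParam 24 τ ^ 24 = q := by
      rw [hqdef, Periodic.qParam, ← Complex.exp_nat_mul]
      congr 1
      push_cast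
      ring
    have h2 (n : ℕ) : 1 - eta_q n τ = 1 + -q ^ (n + 1) := by
      rw [eta_q_eq_pow, ← sub_eq_add_neg]
    rw [discriminant, ModularForm.eta, mul_pow, h1, tprod_congr h2]
  rw [hd, norm_mul, norm_pow]
  calc ‖q‖ * ‖∏' n : ℕ, (1 + -q ^ (n + 1))‖ ^ 24 ≤ 1 / 2500 * Real.exp (1 / 2499) ^ 24 := by
        gcongr
        exact hP.trans (Real.exp_le_exp.mpr hP')
    _ ≤ 1 / 2500 * 1.01 := by gcongr

/-- Numerically, 1728 · 1.01/2500 < 0.7 < 0.729 = 0.9³. -/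
theorem norm_one_div_J_lt_one {τ : ℍ} (hτ : τ ∈ region) : ‖1 / J τ‖ < 1 := by
  have h1 := norm_discriminant_le hτ
  have h2 := norm_E4_ge hτ
  rw [one_div_J, norm_div, norm_mul, norm_pow,
    div_lt_one (by positivity : 0 < ‖E₄ τ‖ ^ 3)]
  have h3 : (0.9 : ℝ) ^ 3 ≤ ‖E₄ τ‖ ^ 3 := by gcongr
  have h4 : ‖(1728 : ℂ)‖ = 1728 := by norm_num
  rw [h4]
  norm_num at h1 h3 ⊢
  linarith

lemma J_ne_zero {τ : ℍ} (hτ : τ ∈ region) : J τ ≠ 0 := by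
  rw [J_eq]
  have hpi : (Real.pi : ℂ) ≠ 0 := by exact_mod_cast Real.pi_ne_zero
  exact div_ne_zero (pow_ne_zero _ (mul_ne_zero (by simp [hpi]) (E4_ne_zero hτ))) (Delta_ne_zero τ)

lemma one_lt_norm_J {τ : ℍ} (hτ : τ ∈ region) : 1 < ‖J τ‖ := by
  have h := norm_one_div_J_lt_one hτ
  rw [norm_div, norm_one] at h
  exact (one_div_lt (norm_pos_iff.mpr (J_ne_zero hτ)) one_pos).mp h |>.trans_eq' (by norm_num)

/-! ### Real values on the imaginary axis -/

lemma exists_exp_eq_ofReal {τ : ℍ} (hτ : τ.re = 0) (c : ℝ) :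
    cexp (2 * Real.pi * Complex.I * τ / c) = (Real.exp (-(2 * Real.pi * τ.im) / c) : ℝ) := by
  have h : (τ : ℂ) = τ.im * Complex.I := by
    apply Complex.ext <;> simp [hτ]
  rw [h]
  push_cast
  congr 1
  linear_combination (2 * Real.pi * (τ.im : ℂ) / c) * Complex.I_sq

/-- Real and nonzero suffices: only the even powers η² and η^24 enter later, so the sign of η is
irrelevant. -/
lemma exists_eta_eq_ofReal {τ : ℍ} (hτ : τ.re = 0) : ∃ x : ℝ, x ≠ 0 ∧ ModularForm.eta τ = x := by
  have h1 := exists_exp_eq_ofReal hτ 1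
  rw [ofReal_one, div_one, div_one] at h1
  set q := Real.exp (-(2 * Real.pi * τ.im))
  have hq : ‖(q : ℂ)‖ < 1 := by
    rw [← h1]
    exact norm_exp_two_pi_I_lt_one τ
  have hm : Multipliable fun n : ℕ ↦ 1 + -q ^ (n + 1) := by
    refine multipliable_one_add_of_summable ?_
    simpa using (summable_nat_add_iff 1).mpr
      (summable_geometric_of_lt_one (norm_nonneg q) (by simpa using hq))
  have h2 : ∏' n, (1 - eta_q n τ) = ((∏' n : ℕ, (1 - q ^ (n + 1)) : ℝ) : ℂ) := by
    simp only [sub_eq_add_neg]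
    refine Eq.trans ?_ (hm.hasProd.map Complex.ofRealHom Complex.continuous_ofReal).tprod_eq
    refine tprod_congr fun n ↦ ?_
    rw [eta_q_eq_pow, h1]
    simp
  have h3 : ModularForm.eta τ = ((Real.exp (-(2 * Real.pi * τ.im) / 24) *
      ∏' n : ℕ, (1 - q ^ (n + 1)) : ℝ) : ℂ) := by
    rw [ModularForm.eta, h2, Periodic.qParam, exists_exp_eq_ofReal hτ, ofReal_mul]
  refine ⟨_, fun h ↦ eta_ne_zero τ.im_pos ?_, h3⟩
  rw [h3, h, ofReal_zero]

lemma exists_E4_eq_ofReal {τ : ℍ} (hτ : τ.re = 0) : ∃ x : ℝ, E₄ τ = x := by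
  have h1 := exists_exp_eq_ofReal hτ 1
  rw [ofReal_one, div_one, div_one] at h1
  refine ⟨1 + 240 * ∑' n : ℕ, (ArithmeticFunction.sigma 3 (n + 1) : ℝ) *
    Real.exp (-(2 * Real.pi * τ.im)) ^ (n + 1), ?_⟩
  rw [E4_eq_tsum, h1]
  push_cast
  rfl

lemma exists_one_div_J_eq_ofReal {τ : ℍ} (hr : τ ∈ region) (hτ : τ.re = 0) :
    ∃ x : ℝ, 0 < x ∧ x < 1 ∧ 1 / J τ = x := by
  obtain ⟨x, hx0, hx⟩ := exists_eta_eq_ofReal hτ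
  obtain ⟨e, he⟩ := exists_E4_eq_ofReal hτ
  have he0 : 0 < e := by
    have h := norm_E4_sub_one_le hr
    have h' : (((e - 1 : ℝ)) : ℂ) = E₄ τ - 1 := by rw [he]; push_cast; rfl
    rw [← h', Complex.norm_real, Real.norm_eq_abs, abs_le] at h
    linarith [h.1]
  have h : 1 / J τ = ((1728 * x ^ 24 / e ^ 3 : ℝ) : ℂ) := by
    rw [one_div_J, he, discriminant, hx]
    push_cast
    rfl
  have hpos : 0 < 1728 * x ^ 24 / e ^ 3 := by positivity
  refine ⟨_, hpos, ?_, h⟩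
  have h1 := norm_one_div_J_lt_one hr
  rwa [h, Complex.norm_real, Real.norm_of_nonneg hpos.le] at h1

end KummerSolution

namespace KummerSolution

open ModularForm EisensteinSeries Filter Topology Manifold Derivative

/-! ### The identity `₂F₁(1/12, 5/12; 1; 1/J)^4 = E₄` -/

lemma hasDerivAt_comp_ofComplex {f : ℍ → ℂ} (hf : MDiff f) (τ : ℍ) :
    HasDerivAt (f ∘ ofComplex) (2 * Real.pi * Complex.I * D f τ) (τ : ℂ) := by
  refine (UpperHalfPlane.mdifferentiableAt_iff.mp (hf τ)).hasDerivAt.congr_deriv ?_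
  rw [normalizedDerivOfComplex, mul_inv_cancel_left₀ two_pi_I_ne_zero]

lemma isPreconnected_image_region : IsPreconnected {z : ℂ | 1.25 < z.im} :=
  (convex_halfSpace_im_gt _).isPreconnected

lemma coe_mem_of_mem_region {τ : ℍ} (hτ : τ ∈ region) : (τ : ℂ) ∈ {z : ℂ | 1.25 < z.im} := hτ

lemma region_mem_atImInfty : region ∈ atImInfty := by
  rw [atImInfty_mem]
  refine ⟨2, fun z hz ↦ ?_⟩
  have : (1.25 : ℝ) < 2 := by norm_num
  exact this.trans_le hz

lemma exists_coe_eq_of_mem {z : ℂ} (hz : z ∈ {z : ℂ | 1.25 < z.im}) :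
    ∃ τ ∈ region, (τ : ℂ) = z := by
  have h : (1.25 : ℝ) < z.im := hz
  exact ⟨⟨z, by linarith⟩, h, rfl⟩

/-- The half-plane is connected and reaches i∞, so the constant can be read off there. -/
lemma eq_limit_of_hasDerivAt_zero {f : ℂ → ℂ} {l : ℂ}
    (hd : ∀ τ ∈ region, HasDerivAt f 0 ((τ : ℍ) : ℂ))
    (hl : Tendsto (fun τ : ℍ ↦ f τ) atImInfty (𝓝 l)) {τ : ℍ} (hτ : τ ∈ region) : f τ = l := by
  have hopen : IsOpen {z : ℂ | 1.25 < z.im} := isOpen_lt continuous_const Complex.continuous_im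
  have hconst (σ : ℍ) (hσ : σ ∈ region) : f τ = f σ := by
    refine hopen.is_const_of_deriv_eq_zero isPreconnected_image_region (fun z hz ↦ ?_)
      (fun z hz ↦ ?_) hτ hσ
    · obtain ⟨σ, hσ, rfl⟩ := exists_coe_eq_of_mem hz
      exact (hd σ hσ).differentiableAt.differentiableWithinAt
    · obtain ⟨σ, hσ, rfl⟩ := exists_coe_eq_of_mem hz
      exact (hd σ hσ).deriv
  refine tendsto_nhds_unique (tendsto_const_nhds.congr' ?_) hl
  filter_upwards [region_mem_atImInfty] with σ hσ using hconst σ hσ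

lemma one_div_J_eq_one_sub {τ : ℍ} (hτ : τ ∈ region) : 1 / J τ = 1 - E₆ τ ^ 2 / E₄ τ ^ 3 := by
  have h := E4_ne_zero hτ
  rw [one_div_J, discriminant_eq_E₄_cube_sub_E₆_sq]
  field_simp

lemma tendsto_one_div_J : Tendsto (fun τ ↦ 1 / J τ) atImInfty (𝓝 0) := by
  have h4 := tendsto_eisensteinSeries_E (k := 4) (by norm_num) ⟨2, rfl⟩
  have h6 := tendsto_eisensteinSeries_E (k := 6) (by norm_num) ⟨3, rfl⟩
  have h := (h6.pow 2).div (h4.pow 3) (by simp)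
  have h' := h.const_sub 1
  norm_num at h'
  refine h'.congr' ?_
  filter_upwards [region_mem_atImInfty] with τ hτ
  rw [one_div_J_eq_one_sub hτ]

/-- In differentiating 1 - E₆²/E₄³ by Ramanujan's equations the E₂ terms cancel, since numerator and
denominator both have weight 12. -/
lemma hasDerivAt_one_div_J {τ : ℍ} (hτ : τ ∈ region) :
    HasDerivAt (fun z ↦ 1 / J (ofComplex z))
      (1 / J τ * (2 * Real.pi * Complex.I * (E₆ τ / E₄ τ))) τ := by
  have h0 := E4_ne_zero hτ
  have h4 := hasDerivAt_comp_ofComplex (ModularFormClass.holo E₄) τ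
  have h6 := hasDerivAt_comp_ofComplex (ModularFormClass.holo E₆) τ
  rw [normalizedDeriv_E4] at h4
  rw [normalizedDeriv_E6] at h6
  have h := ((h6.pow 2).div (h4.pow 3) (by simpa [ofComplex_apply] using h0)).const_sub 1
  have he : (fun z ↦ 1 / J (ofComplex z)) =ᶠ[𝓝 (τ : ℂ)]
      fun z ↦ 1 - ((E₆ ∘ ofComplex) ^ 2 / (E₄ ∘ ofComplex) ^ 3) z := by
    have hopen : IsOpen {z : ℂ | 1.25 < z.im} := isOpen_lt continuous_const Complex.continuous_im
    filter_upwards [hopen.mem_nhds (coe_mem_of_mem_region hτ)] with z hz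
    obtain ⟨σ, hσ, rfl⟩ := exists_coe_eq_of_mem hz
    simp only [Pi.div_apply, Pi.pow_apply, Function.comp_apply, ofComplex_apply]
    exact one_div_J_eq_one_sub hσ
  refine (h.congr_of_eventuallyEq he).congr_deriv ?_
  rw [one_div_J_eq_one_sub hτ]
  simp only [Pi.pow_apply, Function.comp_apply, ofComplex_apply]
  generalize E₄ τ = a at *
  generalize E₆ τ = b at *
  field_simp
  push_cast
  ring

lemma hasDerivAt_hypTheta_one_div_J (k : ℕ) {τ : ℍ} (hτ : τ ∈ region) :
    HasDerivAt (fun z ↦ hypTheta k (1 / J (ofComplex z)))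
      (hypTheta (k + 1) (1 / J τ) * (2 * Real.pi * Complex.I * (E₆ τ / E₄ τ))) τ := by
  have he : 1 / J (ofComplex τ) = 1 / J τ := by rw [ofComplex_apply]
  have h := hypTheta_hasDerivAt_comp k (t := fun z ↦ 1 / J (ofComplex z)) (z := τ)
    (s := 2 * Real.pi * Complex.I * (E₆ τ / E₄ τ)) (by rw [he]; exact norm_one_div_J_lt_one hτ)
    (by rw [he]; exact hasDerivAt_one_div_J hτ)
  rwa [he] at h

/-- The expression whose vanishing says that `₂F₁(1/12, 5/12; 1; 1/J)` and `E₄^(1/4)` have the same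
logarithmic derivative. -/
noncomputable def wronskian (τ : ℍ) : ℂ :=
  12 * E₆ τ * hypTheta 1 (1 / J τ) - hypTheta 0 (1 / J τ) * (E2 τ * E₄ τ - E₆ τ)

lemma hasDerivAt_wronskian {τ : ℍ} (hτ : τ ∈ region) :
    HasDerivAt (wronskian ∘ ofComplex) (2 * Real.pi * Complex.I *
      (5 / 12 * ((E2 τ * E₄ τ - E₆ τ) / E₄ τ) * wronskian τ)) τ := by
  have h0 := E4_ne_zero hτ
  have ht1 := norm_one_div_J_lt_one hτ
  have hF0 := hasDerivAt_hypTheta_one_div_J 0 hτ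
  have hF1 := hasDerivAt_hypTheta_one_div_J 1 hτ
  have h2 := hasDerivAt_comp_ofComplex E2_mdifferentiable τ
  have h4 := hasDerivAt_comp_ofComplex (ModularFormClass.holo E₄) τ
  have h6 := hasDerivAt_comp_ofComplex (ModularFormClass.holo E₆) τ
  rw [normalizedDeriv_E2] at h2
  rw [normalizedDeriv_E4] at h4
  rw [normalizedDeriv_E6] at h6
  have h := ((h6.const_mul 12).mul hF1).sub (hF0.mul ((h2.mul h4).sub h6))
  refine h.congr_deriv ?_
  have hode := hypTheta_equation ht1
  have ht' := one_div_J_eq_one_sub hτ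
  simp only [Pi.mul_apply, Pi.sub_apply, Function.comp_apply, ofComplex_apply, wronskian,
    Nat.reduceAdd, zero_add]
  generalize 1 / J τ = t at *
  generalize hypTheta 0 t = F0 at *
  generalize hypTheta 1 t = F1 at *
  generalize hypTheta 2 t = F2 at *
  generalize E₄ τ = a at *
  generalize E₆ τ = b at *
  generalize E2 τ = e at *
  clear h h2 h4 h6 hF0 hF1 ht1
  -- With 1 - t = E₆²/E₄³ the claim becomes algebraic in E₂, E₄, E₆ and the θ-derivatives; the
  -- hypergeometric equation eliminates θ²F.
  subst ht'
  field_simp at hode ⊢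
  linear_combination 3 * hode

lemma tendsto_hypTheta_one_div_J (k : ℕ) :
    Tendsto (fun τ ↦ hypTheta k (1 / J τ)) atImInfty (𝓝 (hypTheta k 0)) :=
  (continuousAt_hypTheta_zero k).tendsto.comp tendsto_one_div_J

/-- The logarithmic derivative of W would be 5/4 that of E₄, so W^4/E₄^5 is constant. Its limit is 0
because θF vanishes at 0 and E₂E₄ - E₆ → 0. -/
lemma wronskian_eq_zero {τ : ℍ} (hτ : τ ∈ region) : wronskian τ = 0 := by
  have hlim : Tendsto (fun τ : ℍ ↦
      ((wronskian ∘ ofComplex) ^ 4 / (E₄ ∘ ofComplex) ^ 5) (τ : ℂ)) atImInfty (𝓝 0) := by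
    have h4 := tendsto_eisensteinSeries_E (k := 4) (by norm_num) ⟨2, rfl⟩
    have h6 := tendsto_eisensteinSeries_E (k := 6) (by norm_num) ⟨3, rfl⟩
    have h0 := tendsto_hypTheta_one_div_J 0
    have h1 := tendsto_hypTheta_one_div_J 1
    rw [hypTheta_zero_zero] at h0
    rw [hypTheta_succ_zero] at h1
    have h := ((((h6.const_mul 12).mul h1).sub (h0.mul ((tendsto_E2.mul h4).sub h6))).pow 4).div
      (h4.pow 5) (by simp)
    norm_num at h
    refine h.congr fun σ ↦ ?_
    simp [wronskian]
  have h := eq_limit_of_hasDerivAt_zero (fun σ hσ ↦ ?_) hlim hτ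
  · simp only [Pi.div_apply, Pi.pow_apply, Function.comp_apply, ofComplex_apply,
      div_eq_zero_iff] at h
    exact pow_eq_zero_iff (by norm_num) |>.mp (h.resolve_right (pow_ne_zero 5 (E4_ne_zero hτ)))
  · have h0 := E4_ne_zero hσ
    have h4 := hasDerivAt_comp_ofComplex (ModularFormClass.holo E₄) σ
    rw [normalizedDeriv_E4] at h4
    refine (((hasDerivAt_wronskian hσ).pow 4).div (h4.pow 5)
      (by simpa [ofComplex_apply] using h0)).congr_deriv ?_
    simp only [Pi.pow_apply, Function.comp_apply, ofComplex_apply]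
    field_simp
    push_cast
    ring

theorem hypTheta_pow_four {τ : ℍ} (hτ : τ ∈ region) : hypTheta 0 (1 / J τ) ^ 4 = E₄ τ := by
  have hlim : Tendsto (fun τ : ℍ ↦ ((fun z ↦ hypTheta 0 (1 / J (ofComplex z))) ^ 4 /
      (E₄ ∘ ofComplex)) (τ : ℂ)) atImInfty (𝓝 1) := by
    have h4 := tendsto_eisensteinSeries_E (k := 4) (by norm_num) ⟨2, rfl⟩
    have h0 := tendsto_hypTheta_one_div_J 0
    rw [hypTheta_zero_zero] at h0
    have h := (h0.pow 4).div h4 (by simp)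
    norm_num at h
    refine h.congr fun σ ↦ ?_
    simp
  have h := eq_limit_of_hasDerivAt_zero (fun σ hσ ↦ ?_) hlim hτ
  · simp only [Pi.div_apply, Pi.pow_apply, Function.comp_apply, ofComplex_apply] at h
    exact (div_eq_one_iff_eq (E4_ne_zero hτ)).mp h
  · have h0 := E4_ne_zero hσ
    have h4 := hasDerivAt_comp_ofComplex (ModularFormClass.holo E₄) σ
    rw [normalizedDeriv_E4] at h4
    have hF := hasDerivAt_hypTheta_one_div_J 0 hσ
    refine ((hF.pow 4).div h4 (by simpa [ofComplex_apply] using h0)).congr_deriv ?_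
    have hw := wronskian_eq_zero hσ
    simp only [wronskian] at hw
    simp only [Pi.pow_apply, Function.comp_apply, ofComplex_apply, zero_add]
    generalize hypTheta 0 (1 / J σ) = F0 at *
    generalize hypTheta 1 (1 / J σ) = F1 at *
    generalize E₄ σ = a at *
    generalize E₆ σ = b at *
    generalize E2 σ = e at *
    field_simp
    linear_combination (2 * Real.pi * Complex.I * F0 ^ 3) * hw

/-! ### Twelfth roots -/

lemma coe_image_region : UpperHalfPlane.coe '' region = {z : ℂ | 1.25 < z.im} := by
  ext z
  constructor
  · rintro ⟨τ, hτ, rfl⟩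
    exact hτ
  · exact exists_coe_eq_of_mem

lemma isPreconnected_region : IsPreconnected region := by
  rw [← isEmbedding_coe.isInducing.isPreconnected_image, coe_image_region]
  exact isPreconnected_image_region

/-- The image is a connected subset of the finite set of n-th roots of unity. -/
lemma eq_const_of_continuousOn_of_pow_eq_one {X : Type*} [TopologicalSpace X] {s : Set X}
    (hs : IsPreconnected s) {f : X → ℂ} (hf : ContinuousOn f s) {n : ℕ} (hn : 0 < n)
    (h1 : ∀ x ∈ s, f x ^ n = 1) {x y : X} (hx : x ∈ s) (hy : y ∈ s) : f x = f y := by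
  have hfin : {z : ℂ | z ^ n = 1}.Finite := by
    refine (Polynomial.nthRoots n (1 : ℂ)).toFinset.finite_toSet.subset fun z hz ↦ ?_
    simpa [Polynomial.mem_nthRoots hn] using hz
  have hpre := hs.image f hf
  have hsub : (f '' s).Subsingleton :=
    (hfin.subset (by rintro _ ⟨z, hz, rfl⟩; exact h1 z hz)).countable.isTotallyDisconnected
      _ subset_rfl hpre
  exact hsub ⟨x, hx, rfl⟩ ⟨y, hy, rfl⟩

lemma kummerConst_pos : 0 < kummerConst := by
  have := Real.pi_pos
  rw [kummerConst]
  positivity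

lemma kummerConst_pow : (kummerConst : ℂ) ^ 12 = (4 * (Real.pi : ℂ) ^ 4 / 3) ^ 3 := by
  have h : ((12 : ℝ) ^ (1 / 4 : ℝ)) ^ 12 = 12 ^ 3 := by
    rw [← Real.rpow_natCast, ← Real.rpow_mul (by norm_num)]
    norm_num
  have h' : kummerConst ^ 12 = (4 * Real.pi ^ 4 / 3) ^ 3 := by
    rw [kummerConst, div_pow, h]
    ring
  exact_mod_cast h'

lemma F_eq (τ : ℍ) : F τ = hypTheta 0 (1 / J τ) := hypTheta_zero_eq _

lemma F_ne_zero {τ : ℍ} (hτ : τ ∈ region) : F τ ≠ 0 := by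
  intro h
  have h4 := hypTheta_pow_four hτ
  rw [← F_eq, h, zero_pow (by norm_num)] at h4
  exact E4_ne_zero hτ h4.symm

lemma continuousOn_F : ContinuousOn F region := by
  intro τ hτ
  have h := (hasDerivAt_hypTheta_one_div_J 0 hτ).continuousAt
  have h' := ContinuousAt.comp (x := τ) h UpperHalfPlane.continuous_coe.continuousAt
  refine (h'.congr (Eventually.of_forall fun σ ↦ ?_)).continuousWithinAt
  simp [F_eq]

/-- The branch `2π η(τ)²` of `Δ^(1/12)`. -/
noncomputable def deltaRoot (τ : ℍ) : ℂ := 2 * Real.pi * ModularForm.eta τ ^ 2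

/-- The branch of `J^(1/12)` for which Kummer's formula with `deltaRoot` is exact. -/
noncomputable def jRoot (τ : ℍ) : ℂ := kummerConst * F τ / deltaRoot τ

lemma deltaRoot_ne_zero (τ : ℍ) : deltaRoot τ ≠ 0 :=
  mul_ne_zero (by simp [Real.pi_ne_zero]) (pow_ne_zero _ (eta_ne_zero τ.im_pos))

lemma continuous_deltaRoot : Continuous deltaRoot := by
  have h : Continuous fun τ : ℍ ↦ ModularForm.eta τ := continuous_iff_continuousAt.mpr fun τ ↦
    ContinuousAt.comp (x := τ) (differentiableAt_eta_of_mem_upperHalfPlaneSet τ.im_pos).continuousAt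
      UpperHalfPlane.continuous_coe.continuousAt
  exact continuous_const.mul (h.pow 2)

lemma isTwelfthRootBranch_deltaRoot : IsTwelfthRootBranch Delta deltaRoot := by
  refine ⟨continuous_deltaRoot.continuousOn, fun τ _ ↦ ?_⟩
  rw [Delta_eq, deltaRoot, discriminant, mul_pow, ← pow_mul]

/-- Here F^4 = E₄ enters: it turns F^12 into E₄³, the numerator of J up to the constant c^12. -/
lemma isTwelfthRootBranch_jRoot : IsTwelfthRootBranch J jRoot := by
  refine ⟨(continuousOn_const.mul continuousOn_F).div continuous_deltaRoot.continuousOn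
    fun τ _ ↦ deltaRoot_ne_zero τ, fun τ hτ ↦ ?_⟩
  rw [jRoot, div_pow, mul_pow, kummerConst_pow, isTwelfthRootBranch_deltaRoot.2 τ hτ, J_eq,
    ← hypTheta_pow_four hτ, F_eq]
  ring

theorem deltaRoot_eq {τ : ℍ} (hτ : τ ∈ region) :
    deltaRoot τ = kummerConst * (jRoot τ)⁻¹ * F τ := by
  have h1 := F_ne_zero hτ
  have h2 : (kummerConst : ℂ) ≠ 0 := by exact_mod_cast kummerConst_pos.ne'
  rw [jRoot, inv_div]
  field_simp

lemma deltaRoot_pos {τ : ℍ} (h0 : τ.re = 0) : ∃ x : ℝ, 0 < x ∧ deltaRoot τ = x := by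
  obtain ⟨x, hx0, hx⟩ := exists_eta_eq_ofReal h0
  have := Real.pi_pos
  refine ⟨2 * Real.pi * x ^ 2, by positivity, ?_⟩
  rw [deltaRoot, hx]
  push_cast
  rfl

lemma jRoot_pos {τ : ℍ} (hτ : τ ∈ region) (h0 : τ.re = 0) : ∃ y : ℝ, 0 < y ∧ jRoot τ = y := by
  obtain ⟨x, hx0, hx⟩ := deltaRoot_pos h0
  obtain ⟨t, ht0, ht1, ht⟩ := exists_one_div_J_eq_ofReal hτ h0
  obtain ⟨y, hy0, hy⟩ := exists_pos_eq_hypTheta ht0.le ht1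
  have := kummerConst_pos
  refine ⟨kummerConst * y / x, by positivity, ?_⟩
  rw [jRoot, F_eq, ht, hy, hx]
  push_cast
  rfl

end KummerSolution

theorem mainTheorem6 :
    -- every expression in the formula is well defined on the half-plane
    (∀ τ ∈ KummerSolution.region,
      KummerSolution.Delta τ ≠ 0 ∧ 1 < ‖KummerSolution.J τ‖ ∧
      Summable fun n : ℕ ↦
        ‖ordinaryHypergeometricCoefficient (1 / 12 : ℂ) (5 / 12 : ℂ) (1 : ℂ) n
          * (1 / KummerSolution.J τ) ^ n‖) ∧
    -- the formula is exact for the branches that are positive on the imaginary axis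
    (∃ δ j : ℍ → ℂ,
      KummerSolution.IsTwelfthRootBranch KummerSolution.Delta δ ∧
      KummerSolution.IsTwelfthRootBranch KummerSolution.J j ∧
      (∀ τ ∈ KummerSolution.region, τ.re = 0 →
        (∃ x : ℝ, 0 < x ∧ δ τ = x) ∧ (∃ y : ℝ, 0 < y ∧ j τ = y)) ∧
      ∀ τ ∈ KummerSolution.region,
        δ τ = KummerSolution.kummerConst * (j τ)⁻¹ * KummerSolution.F τ) ∧
    -- for any other branches it holds up to a constant twelfth root of unity
    (∀ δ j : ℍ → ℂ,
      KummerSolution.IsTwelfthRootBranch KummerSolution.Delta δ →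
      KummerSolution.IsTwelfthRootBranch KummerSolution.J j →
      ∃ ζ : ℂ, ζ ^ 12 = 1 ∧ ∀ τ ∈ KummerSolution.region,
        δ τ = ζ * (KummerSolution.kummerConst * (j τ)⁻¹ * KummerSolution.F τ)) := by
  refine ⟨fun τ hτ ↦ ⟨KummerSolution.Delta_ne_zero τ, KummerSolution.one_lt_norm_J hτ, ?_⟩,
    ⟨KummerSolution.deltaRoot, KummerSolution.jRoot,
      KummerSolution.isTwelfthRootBranch_deltaRoot, KummerSolution.isTwelfthRootBranch_jRoot,
      fun τ hτ h0 ↦ ⟨KummerSolution.deltaRoot_pos h0, KummerSolution.jRoot_pos hτ h0⟩,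
      fun τ hτ ↦ KummerSolution.deltaRoot_eq hτ⟩, fun δ j hδ hj ↦ ?_⟩
  · have h := (KummerSolution.summable_hypTheta 0 (KummerSolution.norm_one_div_J_lt_one hτ)).norm
    simpa only [pow_zero, one_mul] using h
  · have hδ0 := KummerSolution.isTwelfthRootBranch_deltaRoot
    have hj0 := KummerSolution.isTwelfthRootBranch_jRoot
    have hJ (τ : ℍ) (hτ : τ ∈ KummerSolution.region) : KummerSolution.jRoot τ ≠ 0 := fun h ↦ by
      have h1 := hj0.2 τ hτ
      rw [h, zero_pow (by norm_num)] at h1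
      exact KummerSolution.J_ne_zero hτ h1.symm
    have hjn (τ : ℍ) (hτ : τ ∈ KummerSolution.region) : j τ ≠ 0 := fun h ↦ by
      have h1 := hj.2 τ hτ
      rw [h, zero_pow (by norm_num)] at h1
      exact KummerSolution.J_ne_zero hτ h1.symm
    -- Kummer's formula says that δ·j equals c·F, so the product of the two branches is compared
    -- with the exact pair; ρ is the required ζ.
    let ρ : ℍ → ℂ := fun τ ↦
      δ τ * j τ / (KummerSolution.deltaRoot τ * KummerSolution.jRoot τ)
    have hρ : ContinuousOn ρ KummerSolution.region :=
      (hδ.1.mul hj.1).div (hδ0.1.mul hj0.1)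
        fun τ hτ ↦ mul_ne_zero (KummerSolution.deltaRoot_ne_zero τ) (hJ τ hτ)
    have hρ1 (τ : ℍ) (hτ : τ ∈ KummerSolution.region) : ρ τ ^ 12 = 1 := by
      simp only [ρ]
      rw [div_pow, mul_pow, mul_pow, hδ.2 τ hτ, hj.2 τ hτ, hδ0.2 τ hτ, hj0.2 τ hτ]
      exact div_self (mul_ne_zero (KummerSolution.Delta_ne_zero τ) (KummerSolution.J_ne_zero hτ))
    have hbase : (⟨2 * Complex.I, by simp⟩ : ℍ) ∈ KummerSolution.region := by
      change (1.25 : ℝ) < (2 * Complex.I).im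
      norm_num
    refine ⟨ρ ⟨2 * Complex.I, by simp⟩, hρ1 _ hbase, fun τ hτ ↦ ?_⟩
    rw [KummerSolution.eq_const_of_continuousOn_of_pow_eq_one
      KummerSolution.isPreconnected_region hρ (by norm_num) hρ1 hbase hτ]
    have h1 := KummerSolution.deltaRoot_eq hτ
    have h2 := hJ τ hτ
    have h3 := hjn τ hτ
    have h4 := KummerSolution.deltaRoot_ne_zero τ
    have h5 : (KummerSolution.kummerConst : ℂ) * KummerSolution.F τ =
        KummerSolution.deltaRoot τ * KummerSolution.jRoot τ := by
      rw [h1]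
      field_simp
    simp only [ρ]
    rw [mul_right_comm, h5]
    field_simp
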